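/- Let $\mathbb K$ be $\mathbb R$ or $\mathbb C$ and let $0\to B\xrightarrow{\,i\,}A\xrightarrow{\,j\,}D\to0$ be an extension of (not necessarily unital) Banach algebras over $\mathbb K$, i.e. $i$ and $j$ are continuous algebra homomorphisms, $i$ is injective, $j$ is surjective and $\operatorname{Im} i=\operatorname{Ker} j$. For a Banach algebra $E$ and $n\ge0$ let $C_n(E)=E^{\hat\otimes(n+1)}$ be the $(n+1)$-fold projective tensor power, let $t_n:C_n(E)\to C_n(E)$ be the continuous linear operator with $$t_n(a_0\otimes a_1\otimes\cdots\otimes a_n)=(-1)^n\,a_n\otimes a_0\otimes\cdots\otimes a_{n-1},$$ and let $CC_n(E)$ be the quotient of $C_n(E)$ by the closure of $\operatorname{Im}(\mathrm{id}-t_n)$; write $[u]$ for the class of $u$. Let $\tilde\imath_n:CC_n(B)\to CC_n(A)$ and $\tilde\jmath_n:CC_n(A)\to CC_n(D)$ be the operators induced by $i^{\hat\otimes(n+1)}$ and $j^{\hat\otimes(n+1)}$. Suppose that $B$ has a left or a right bounded approximate identity, i.e. a bounded net $(e_\alpha)_{\alpha\in\Lambda}$ in $B$ such that $e_\alpha b\to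 b$ for all $b\in B$, or $be_\alpha\to b$ for all $b\in B$. Then for every $n\ge0$: 1. $\tilde\jmath_n\circ\tilde\imath_n=0$; 2. $\tilde\imath_n$ is injective and its image is closed in $CC_n(A)$; 3. $\tilde\jmath_n$ is surjective; 4. $\operatorname{Ker}\tilde\jmath_n=\{[u] : u\in\operatorname{Ker} j^{\hat\otimes(n+1)}\}$; 5. $\operatorname{Ker}\tilde\jmath_n$ is the closure in $CC_n(A)$ of the linear span of $\{[a_0\otimes a_1\otimes\cdots\otimes a_n] : a_0,\dots,a_n\in A,\ a_k\in i(B)\text{ for at least one }k\}$. -/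

import Mathlib

open scoped TensorProduct Topology

noncomputable section

namespace BanachCyclic

open PiTensorProduct UniformSpace

section Chains

variable (𝕜 : Type*) [RCLike 𝕜]
variable (A : Type*) [NormedAddCommGroup A] [NormedSpace 𝕜 A]

/-- `C_n(A)`: the `(n+1)`-fold projective tensor power of the Banach space `A`, that is the
completion of the algebraic tensor power for the projective norm (the norm that Mathlib puts on
`⨂[𝕜] _, A`). -/
abbrev Chain (n : ℕ) : Type _ :=
  Completion (⨂[𝕜] _ : Fin (n + 1), A)

variable {A} in
/-- The elementary tensor `a 0 ⊗ a 1 ⊗ ⋯ ⊗ a n` in `C_n(A)`. -/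
def elem {n : ℕ} (a : Fin (n + 1) → A) : Chain 𝕜 A n :=
  ((⨂ₜ[𝕜] k, a k : ⨂[𝕜] _ : Fin (n + 1), A) : Completion (⨂[𝕜] _ : Fin (n + 1), A))

/-- The signed cyclic shift on the algebraic tensor power. -/
def algCyclic (n : ℕ) :
    (⨂[𝕜] _ : Fin (n + 1), A) →L[𝕜] (⨂[𝕜] _ : Fin (n + 1), A) :=
  (-1 : 𝕜) ^ n • liftIsometry 𝕜 (fun _ : Fin (n + 1) => A) _
    ((tprodL 𝕜 (E := fun _ : Fin (n + 1) => A)).domDomCongr (finRotate (n + 1)).symm)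

/-- The operator `t_n : C_n(A) → C_n(A)`, the continuous linear extension of
`a₀ ⊗ a₁ ⊗ ⋯ ⊗ aₙ ↦ (-1)ⁿ aₙ ⊗ a₀ ⊗ ⋯ ⊗ aₙ₋₁` (see `cyclic_elem`). -/
def cyclic (n : ℕ) : Chain 𝕜 A n →L[𝕜] Chain 𝕜 A n :=
  (algCyclic 𝕜 A n).completion

/-- The closure of the linear subspace `{x - t_n x}` of `C_n(A)`. -/
def cyclicRel (n : ℕ) : Submodule 𝕜 (Chain 𝕜 A n) :=
  (LinearMap.range
    (ContinuousLinearMap.id 𝕜 (Chain 𝕜 A n) - cyclic 𝕜 A n).toLinearMap).topologicalClosure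

/-- `CC_n(A)`, with the quotient topology (the topology of the quotient norm). -/
abbrev CyclicChain (n : ℕ) : Type _ := Chain 𝕜 A n ⧸ cyclicRel 𝕜 A n

theorem algCyclic_tprod (n : ℕ) (a : Fin (n + 1) → A) :
    algCyclic 𝕜 A n (⨂ₜ[𝕜] k, a k) =
      (-1 : 𝕜) ^ n • ⨂ₜ[𝕜] k, a ((finRotate (n + 1)).symm k) := by
  simp [algCyclic]

variable {A} in
theorem cyclic_elem {n : ℕ} (a : Fin (n + 1) → A) :
    cyclic 𝕜 A n (elem 𝕜 a) = (-1 : 𝕜) ^ n • elem 𝕜 (fun k => a (k - 1)) := by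
  have h : ∀ k : Fin (n + 1), (finRotate (n + 1)).symm k = k - 1 := by
    intro k
    rw [Equiv.symm_apply_eq, finRotate_apply, sub_add_cancel]
  simp only [cyclic, elem, ContinuousLinearMap.completion_apply_coe, algCyclic_tprod,
    Completion.coe_smul, h]

end Chains

section Maps

variable {𝕜 : Type*} [RCLike 𝕜]
variable {A : Type*} [NormedAddCommGroup A] [NormedSpace 𝕜 A]
variable {B : Type*} [NormedAddCommGroup B] [NormedSpace 𝕜 B]

/-- `f ⊗ ⋯ ⊗ f : C_n(A) → C_n(B)`. -/
def chainMap (f : A →L[𝕜] B) (n : ℕ) : Chain 𝕜 A n →L[𝕜] Chain 𝕜 B n :=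
  (mapL (fun _ : Fin (n + 1) => f)).completion

theorem chainMap_elem (f : A →L[𝕜] B) {n : ℕ} (a : Fin (n + 1) → A) :
    chainMap f n (elem 𝕜 a) = elem 𝕜 (fun k => f (a k)) := by
  simp [chainMap, elem]

theorem chainMap_cyclic (f : A →L[𝕜] B) (n : ℕ) (x : Chain 𝕜 A n) :
    chainMap f n (cyclic 𝕜 A n x) = cyclic 𝕜 B n (chainMap f n x) := by
  have h : ∀ y : ⨂[𝕜] _ : Fin (n + 1), A,
      mapL (fun _ : Fin (n + 1) => f) (algCyclic 𝕜 A n y) =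
        algCyclic 𝕜 B n (mapL (fun _ : Fin (n + 1) => f) y) := by
    intro y
    induction y using PiTensorProduct.induction_on with
    | smul_tprod r a =>
      rw [map_smul, map_smul, map_smul, map_smul, algCyclic_tprod, map_smul]
      simp only [mapL_apply, map_tprod, ContinuousLinearMap.coe_coe, algCyclic_tprod]
    | add x y hx hy => rw [map_add, map_add, map_add, map_add, hx, hy]
  induction x using Completion.induction_on with
  | hp =>
    exact isClosed_eq ((chainMap f n).continuous.comp (cyclic 𝕜 A n).continuous)
      ((cyclic 𝕜 B n).continuous.comp (chainMap f n).continuous)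
  | ih y => simp only [chainMap, cyclic, ContinuousLinearMap.completion_apply_coe, h]

theorem cyclicRel_le_comap (f : A →L[𝕜] B) (n : ℕ) :
    cyclicRel 𝕜 A n ≤ (cyclicRel 𝕜 B n).comap (chainMap f n).toLinearMap := by
  refine Submodule.topologicalClosure_minimal _ ?_
    ((Submodule.isClosed_topologicalClosure _).preimage (chainMap f n).continuous)
  rintro _ ⟨x, rfl⟩
  refine Submodule.le_topologicalClosure _ ⟨chainMap f n x, ?_⟩
  simp [chainMap_cyclic]

/-- The operator `CC_n(A) → CC_n(B)` induced by `f ⊗ ⋯ ⊗ f`. -/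
def cyclicMap (f : A →L[𝕜] B) (n : ℕ) : CyclicChain 𝕜 A n →L[𝕜] CyclicChain 𝕜 B n where
  toLinearMap := Submodule.mapQ _ _ (chainMap f n).toLinearMap (cyclicRel_le_comap f n)
  cont := continuous_quot_lift _
    (continuous_quot_mk.comp (chainMap f n).continuous)

theorem cyclicMap_mk (f : A →L[𝕜] B) (n : ℕ) (x : Chain 𝕜 A n) :
    cyclicMap f n ((cyclicRel 𝕜 A n).mkQ x) = (cyclicRel 𝕜 B n).mkQ (chainMap f n x) :=
  rfl

end Maps

/-- `0 → B → A → D → 0` is an extension of Banach algebras: `i` and `j` are continuous algebra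
homomorphisms and the sequence is exact. -/
structure IsExtension {𝕜 B A D : Type*} [RCLike 𝕜]
    [NonUnitalNormedRing B] [NormedSpace 𝕜 B]
    [NonUnitalNormedRing A] [NormedSpace 𝕜 A]
    [NonUnitalNormedRing D] [NormedSpace 𝕜 D]
    (i : B →L[𝕜] A) (j : A →L[𝕜] D) : Prop where
  map_mul_left : ∀ x y : B, i (x * y) = i x * i y
  map_mul_right : ∀ x y : A, j (x * y) = j x * j y
  injective : Function.Injective i
  exact : ∀ a : A, j a = 0 ↔ a ∈ Set.range i
  surjective : Function.Surjective j

/-- The net `e` is a left bounded approximate identity of `B`. -/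
structure IsLeftBAI {B Λ : Type*} [NonUnitalNormedRing B] [Preorder Λ] (e : Λ → B) : Prop where
  bounded : ∃ M : ℝ, ∀ α, ‖e α‖ ≤ M
  tendsto : ∀ b : B, Filter.Tendsto (fun α => e α * b) Filter.atTop (𝓝 b)

/-- The net `e` is a right bounded approximate identity of `B`. -/
structure IsRightBAI {B Λ : Type*} [NonUnitalNormedRing B] [Preorder Λ] (e : Λ → B) : Prop where
  bounded : ∃ M : ℝ, ∀ α, ‖e α‖ ≤ M
  tendsto : ∀ b : B, Filter.Tendsto (fun α => b * e α) Filter.atTop (𝓝 b)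

end BanachCyclic

end

/-! For a surjection `j`, a bounded multilinear map that vanishes whenever an argument lies in `Ker
j` factors through `j`, by a bounded nonlinear section. Passing to tensor powers
(`exists_chain_factor`), this makes `chainMap j n` surjective with kernel the closed span of the
tensors having an entry in `Ker j`. To descend to cyclic chains, note that `t ^ (n + 1) = 1`, so
averaging shows that the range of `1 - t` is already closed (`mem_cyclicRel_iff`). A chain of `A`
whose image is some `d - t d` can therefore be corrected, after lifting `d`, to one killed by
`chainMap j n`.

Only the claims on `i` use the approximate identity. Multiplication by `i (e α)` sends `A` into the
ideal `i(B)`, giving a bounded net of operators `S α : A → B` with `S α ∘ i → id` pointwise. Their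
tensor powers commute with `t`, and in the limit they bound `cyclicMap i n` below. -/

namespace BanachCyclic

open PiTensorProduct UniformSpace Filter

/-! ### Multilinear maps factoring through a surjection -/

section Factorization

variable {𝕜 : Type*} [RCLike 𝕜] {ι : Type*} [Fintype ι]
variable {A D Q : Type*} [NormedAddCommGroup A] [NormedSpace 𝕜 A]
  [NormedAddCommGroup D] [NormedSpace 𝕜 D] [NormedAddCommGroup Q] [NormedSpace 𝕜 Q]

/-- A multilinear map that vanishes as soon as one argument is in the kernel of `j` depends only on
the images of its arguments under `j`. -/
theorem multilinear_eq_of_map_eq {j : A →L[𝕜] D}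
    (m : MultilinearMap 𝕜 (fun _ : ι => A) Q) (hm : ∀ a k, j (a k) = 0 → m a = 0)
    {a a' : ι → A} (h : ∀ k, j (a k) = j (a' k)) : m a = m a' := by
  classical
  have key : ∀ s : Finset ι, m (s.piecewise a' a) = m a := by
    intro s
    induction s using Finset.induction_on with
    | empty => simp
    | insert k s hk ih =>
      rw [← ih, Finset.piecewise_insert, ← sub_eq_zero]
      -- The two tuples differ only in slot `k`, so by linearity there the difference is a value of
      -- `m` with entry `a' k - a k` or its negative, which `j` kills.
      have h1 : s.piecewise a' a = Function.update (s.piecewise a' a) k (a k) := by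
        rw [eq_comm, Function.update_eq_self_iff, Finset.piecewise_eq_of_notMem _ _ _ hk]
      conv_lhs => rw [h1, Function.update_idem, ← MultilinearMap.map_update_sub]
      refine hm _ k ?_
      rw [Function.update_self, map_sub, h k, sub_self]
  rw [← key Finset.univ, Finset.piecewise_univ]

/-- A continuous multilinear map that vanishes as soon as one argument is in the kernel of the
surjection `j` factors through `j`. -/
theorem exists_multilinear_factor [CompleteSpace A] [CompleteSpace D] {j : A →L[𝕜] D}
    (hj : Function.Surjective j)
    (m : ContinuousMultilinearMap 𝕜 (fun _ : ι => A) Q) (hm : ∀ a k, j (a k) = 0 → m a = 0) :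
    ∃ m' : ContinuousMultilinearMap 𝕜 (fun _ : ι => D) Q, ∀ a, m' (fun k => j (a k)) = m a := by
  -- The open mapping theorem gives a section with `‖s d‖ ≤ C ‖d‖`. It need not be linear, but `m`
  -- sees its arguments only modulo `Ker j`, so `m ∘ s` is still multilinear.
  obtain ⟨C, hC, hs⟩ := j.exists_preimage_norm_le hj
  choose s hs hsn using hs
  have hm' : ∀ {a a' : ι → A}, (∀ k, j (a k) = j (a' k)) → m a = m a' :=
    fun h => multilinear_eq_of_map_eq m.toMultilinearMap hm h
  let m₀ : MultilinearMap 𝕜 (fun _ : ι => D) Q :=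
    { toFun := fun d => m (fun k => s (d k))
      map_update_add' := by
        intro _ d k x y
        have h : ∀ z, (m fun l => s (Function.update d k z l)) =
            m (Function.update (fun l => s (d l)) k (s z)) := fun z => hm' fun l => by
          rcases eq_or_ne l k with rfl | hl
          · simp
          · simp [hl]
        rw [h x, h y, ← m.map_update_add]
        refine hm' fun l => ?_
        rcases eq_or_ne l k with rfl | hl
        · simp [hs]
        · simp [hl]
      map_update_smul' := by
        intro _ d k c x
        have h : ∀ z, (m fun l => s (Function.update d k z l)) =
            m (Function.update (fun l => s (d l)) k (s z)) := fun z => hm' fun l => by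
          rcases eq_or_ne l k with rfl | hl
          · simp
          · simp [hl]
        rw [h x, ← m.map_update_smul]
        refine hm' fun l => ?_
        rcases eq_or_ne l k with rfl | hl
        · simp [hs]
        · simp [hl] }
  refine ⟨m₀.mkContinuous (‖m‖ * C ^ Fintype.card ι) fun d => ?_, fun a => ?_⟩
  · calc ‖m fun k => s (d k)‖ ≤ ‖m‖ * ∏ k, ‖s (d k)‖ := m.le_opNorm _
      _ ≤ ‖m‖ * ∏ k, (C * ‖d k‖) := by
        gcongr with k
        exact hsn (d k)
      _ = ‖m‖ * C ^ Fintype.card ι * ∏ k, ‖d k‖ := by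
        rw [Finset.prod_mul_distrib, Finset.prod_const, Finset.card_univ, mul_assoc]
  · exact hm' fun k => hs _

end Factorization

/-! ### Density of elementary tensors and norm bounds for induced maps -/

section ChainMaps

variable {𝕜 : Type*} [RCLike 𝕜]
variable {A : Type*} [NormedAddCommGroup A] [NormedSpace 𝕜 A]
variable {B : Type*} [NormedAddCommGroup B] [NormedSpace 𝕜 B]
variable {D : Type*} [NormedAddCommGroup D] [NormedSpace 𝕜 D]

theorem elem_eq_tprodL {n : ℕ} (a : Fin (n + 1) → A) :
    elem 𝕜 a = ((tprodL 𝕜 a : ⨂[𝕜] _ : Fin (n + 1), A) : Chain 𝕜 A n) := by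
  simp [elem]

theorem continuous_elem {n : ℕ} : Continuous (elem 𝕜 : (Fin (n + 1) → A) → Chain 𝕜 A n) := by
  have : (elem 𝕜 : (Fin (n + 1) → A) → Chain 𝕜 A n) =
      (fun x : ⨂[𝕜] _ : Fin (n + 1), A => (x : Chain 𝕜 A n)) ∘ tprodL 𝕜 :=
    funext elem_eq_tprodL
  rw [this]
  exact (Completion.continuous_coe _).comp (tprodL 𝕜).cont

theorem elem_map_zero {n : ℕ} {a : Fin (n + 1) → A} {k : Fin (n + 1)} (h : a k = 0) :
    elem 𝕜 a = 0 := by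
  rw [elem_eq_tprodL, ContinuousMultilinearMap.map_coord_zero _ k h, Completion.coe_zero]

/-- The elementary tensors span a dense subspace. -/
theorem chain_induction {n : ℕ} {p : Chain 𝕜 A n → Prop} (hc : IsClosed {x | p x})
    (hsmul : ∀ (c : 𝕜) a, p (c • elem 𝕜 a)) (hadd : ∀ x y, p x → p y → p (x + y))
    (x : Chain 𝕜 A n) : p x := by
  induction x using Completion.induction_on with
  | hp => exact hc
  | ih y =>
    induction y using PiTensorProduct.induction_on with
    | smul_tprod r a => simpa only [Completion.coe_smul, elem] using hsmul r a
    | add x y hx hy => simpa only [Completion.coe_add] using hadd _ _ hx hy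

theorem chain_ext {Q : Type*} [AddCommGroup Q] [Module 𝕜 Q] [TopologicalSpace Q] [T2Space Q]
    {n : ℕ} {f g : Chain 𝕜 A n →L[𝕜] Q} (h : ∀ a, f (elem 𝕜 a) = g (elem 𝕜 a)) : f = g := by
  ext x
  induction x using chain_induction with
  | hc => exact isClosed_eq f.continuous g.continuous
  | hsmul c a => rw [map_smul, map_smul, h]
  | hadd x y hx hy => rw [map_add, map_add, hx, hy]

theorem chainMap_comp_apply (g : B →L[𝕜] D) (f : A →L[𝕜] B) (n : ℕ) (x : Chain 𝕜 A n) :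
    chainMap (g ∘L f) n x = chainMap g n (chainMap f n x) := by
  refine DFunLike.congr_fun
    (chain_ext (f := chainMap (g ∘L f) n) (g := chainMap g n ∘L chainMap f n) fun a => ?_) x
  simp [chainMap_elem]

theorem norm_chainMap_apply_le (f : A →L[𝕜] B) (n : ℕ) (x : Chain 𝕜 A n) :
    ‖chainMap f n x‖ ≤ ‖f‖ ^ (n + 1) * ‖x‖ := by
  induction x using Completion.induction_on with
  | hp => exact isClosed_le (by fun_prop) (by fun_prop)
  | ih y =>
    rw [chainMap, ContinuousLinearMap.completion_apply_coe, Completion.norm_coe,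
      Completion.norm_coe]
    refine (ContinuousLinearMap.le_opNorm _ y).trans ?_
    gcongr
    simpa using opNorm_mapL (fun _ : Fin (n + 1) => f)

instance isClosed_cyclicRel (n : ℕ) : IsClosed (cyclicRel 𝕜 A n : Set (Chain 𝕜 A n)) :=
  Submodule.isClosed_topologicalClosure _

theorem norm_cyclicMap_apply_le (f : A →L[𝕜] B) (n : ℕ) (x : CyclicChain 𝕜 A n) :
    ‖cyclicMap f n x‖ ≤ ‖f‖ ^ (n + 1) * ‖x‖ := by
  refine le_of_forall_pos_le_add fun ε hε => ?_
  -- The `+ 1` keeps the denominator positive when `f = 0`.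
  have hδ : 0 < ε / (‖f‖ ^ (n + 1) + 1) := by positivity
  obtain ⟨u, rfl, hu⟩ := Submodule.Quotient.norm_mk_lt x hδ
  calc ‖cyclicMap f n (Submodule.Quotient.mk u)‖ ≤ ‖chainMap f n u‖ :=
        Submodule.Quotient.norm_mk_le _ _
    _ ≤ ‖f‖ ^ (n + 1) * ‖u‖ := norm_chainMap_apply_le f n u
    _ ≤ ‖f‖ ^ (n + 1) * (_ + ε / (‖f‖ ^ (n + 1) + 1)) := by gcongr
    _ ≤ _ := by
      rw [mul_add]
      gcongr
      rw [mul_div_assoc', div_le_iff₀ (by positivity)]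
      nlinarith

/-! ### The kernel and the range of `j ⊗ ⋯ ⊗ j` for a surjection `j` -/

theorem exists_chain_factor [CompleteSpace A] [CompleteSpace D] {j : A →L[𝕜] D}
    (hj : Function.Surjective j) {n : ℕ} {Q : Type*} [NormedAddCommGroup Q] [NormedSpace 𝕜 Q]
    [CompleteSpace Q] (q : Chain 𝕜 A n →L[𝕜] Q)
    (hq : ∀ a k, j (a k) = 0 → q (elem 𝕜 a) = 0) :
    ∃ ψ : Chain 𝕜 D n →L[𝕜] Q, ψ ∘L chainMap j n = q := by
  let c : (⨂[𝕜] _ : Fin (n + 1), A) →L[𝕜] Q := q ∘L Completion.toComplL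
  have hc : ∀ a, c (tprodL 𝕜 a) = q (elem 𝕜 a) := fun a => by
    rw [elem_eq_tprodL]; rfl
  obtain ⟨m', hm'⟩ := exists_multilinear_factor hj (c.compContinuousMultilinearMap (tprodL 𝕜))
    fun a k h => (hc a).trans (hq a k h)
  refine ⟨(liftIsometry 𝕜 _ _ m').fromCompletion, chain_ext fun a => ?_⟩
  rw [ContinuousLinearMap.comp_apply, chainMap_elem, elem,
    ContinuousLinearMap.fromCompletion_apply_coe, liftIsometry_apply_apply, lift.tprod]
  exact (hm' a).trans (hc a)

/-- The quotient map by `L` factors through `chainMap j n`, so it kills the kernel. -/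
theorem ker_chainMap_le [CompleteSpace A] [CompleteSpace D] {j : A →L[𝕜] D}
    (hj : Function.Surjective j) {n : ℕ} (L : Submodule 𝕜 (Chain 𝕜 A n))
    (hL : IsClosed (L : Set (Chain 𝕜 A n))) (h : ∀ a k, j (a k) = 0 → elem 𝕜 a ∈ L) :
    LinearMap.ker (chainMap j n).toLinearMap ≤ L := by
  have : IsClosed (L : Set (Chain 𝕜 A n)) := hL
  obtain ⟨ψ, hψ⟩ := exists_chain_factor hj L.mkQL
    fun a k hk => (Submodule.Quotient.mk_eq_zero L).2 (h a k hk)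
  intro x hx
  have h0 : chainMap j n x = 0 := hx
  have := DFunLike.congr_fun hψ x
  rw [ContinuousLinearMap.comp_apply, h0, map_zero] at this
  exact (Submodule.Quotient.mk_eq_zero L).1 this.symm

/-- The quotient by the kernel factors through `chainMap j n` via `ψ`, and `ψ` is a right inverse of
the induced map `φ`, as seen on elementary tensors. -/
theorem chainMap_surjective [CompleteSpace A] [CompleteSpace D] {j : A →L[𝕜] D}
    (hj : Function.Surjective j) (n : ℕ) : Function.Surjective (chainMap j n) := by
  let L : Submodule 𝕜 (Chain 𝕜 A n) := LinearMap.ker (chainMap j n).toLinearMap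
  have hL : IsClosed (L : Set (Chain 𝕜 A n)) := (chainMap j n).isClosed_ker
  obtain ⟨ψ, hψ⟩ := exists_chain_factor hj L.mkQL fun a k hk =>
    (Submodule.Quotient.mk_eq_zero L).2 (by
      change chainMap j n _ = 0
      rw [chainMap_elem]
      exact elem_map_zero hk)
  let φ : (Chain 𝕜 A n ⧸ L) →L[𝕜] Chain 𝕜 D n := L.liftQL (chainMap j n) le_rfl
  have hφ : φ ∘L ψ = ContinuousLinearMap.id 𝕜 _ := chain_ext fun d => by
    choose a ha using fun k => hj (d k)
    have h1 : chainMap j n (elem 𝕜 a) = elem 𝕜 d := by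
      rw [chainMap_elem]; simp only [ha]
    have h2 := DFunLike.congr_fun hψ (elem 𝕜 a)
    rw [ContinuousLinearMap.comp_apply, h1] at h2
    rw [ContinuousLinearMap.comp_apply, h2]
    exact h1
  intro y
  obtain ⟨u, hu⟩ := L.mkQ_surjective (ψ y)
  refine ⟨u, ?_⟩
  have := DFunLike.congr_fun hφ y
  rw [ContinuousLinearMap.comp_apply, ← hu] at this
  exact this

theorem cyclicMap_surjective [CompleteSpace A] [CompleteSpace D] {j : A →L[𝕜] D}
    (hj : Function.Surjective j) (n : ℕ) : Function.Surjective (cyclicMap j n) := by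
  intro y
  obtain ⟨v, rfl⟩ := (cyclicRel 𝕜 D n).mkQ_surjective y
  obtain ⟨u, rfl⟩ := chainMap_surjective hj n v
  exact ⟨(cyclicRel 𝕜 A n).mkQ u, rfl⟩

/-! ### The range of `id - t` is closed -/

theorem cyclic_pow_elem {n : ℕ} (m : ℕ) (a : Fin (n + 1) → A) :
    (cyclic 𝕜 A n ^ m) (elem 𝕜 a) = ((-1 : 𝕜) ^ n) ^ m • elem 𝕜 (fun k => a (k - m • 1)) := by
  induction m with
  | zero => simp
  | succ m ih =>
    rw [pow_succ', mul_apply_eq_comp, ih, map_smul, cyclic_elem, smul_smul, ← pow_succ]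
    congr 2
    ext k
    congr 1
    rw [succ_nsmul]
    abel

theorem cyclic_pow_eq_one (n : ℕ) : cyclic 𝕜 A n ^ (n + 1) = 1 := by
  refine chain_ext fun a => ?_
  rw [cyclic_pow_elem, ← pow_mul, (Nat.even_mul_succ_self n).neg_one_pow, one_smul]
  have h : (n + 1) • (1 : Fin (n + 1)) = 0 := by
    simpa using card_nsmul_eq_zero (x := (1 : Fin (n + 1)))
  simp only [h, sub_zero]
  rfl

/-- If `T ^ m = 1`, an element killed by `1 + T + ⋯ + T ^ (m - 1)` is in the range of `1 - T`. -/
theorem exists_sub_eq_of_sum_pow_eq_zero {E : Type*} [NormedAddCommGroup E] [NormedSpace 𝕜 E]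
    (T : E →L[𝕜] E) (m : ℕ) {x : E}
    (hx : (∑ k ∈ Finset.range (m + 1), T ^ k) x = 0) : ∃ y, y - T y = x := by
  let S : E →L[𝕜] E := ∑ k ∈ Finset.range (m + 1), ∑ i ∈ Finset.range k, T ^ i
  -- Each inner geometric sum telescopes to `1 - T ^ k`; dividing by `m + 1` then inverts `1 - T` on
  -- the kernel of the full sum.
  have hS : (1 - T) * S = (m + 1 : 𝕜) • (1 : E →L[𝕜] E) - ∑ k ∈ Finset.range (m + 1), T ^ k := by
    simp only [S, Finset.mul_sum (Finset.range (m + 1)), mul_neg_geom_sum, Finset.sum_sub_distrib,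
      Finset.sum_const, Finset.card_range]
    rw [← Nat.cast_smul_eq_nsmul 𝕜, Nat.cast_succ]
  have hm : (m + 1 : 𝕜) ≠ 0 := by exact_mod_cast Nat.succ_ne_zero m
  refine ⟨(m + 1 : 𝕜)⁻¹ • S x, ?_⟩
  have := DFunLike.congr_fun hS x
  rw [sub_apply, hx, sub_zero] at this
  rw [map_smul, ← smul_sub]
  exact (congrArg ((m + 1 : 𝕜)⁻¹ • ·) this).trans (by simp [smul_smul, hm])

theorem mem_cyclicRel_iff {n : ℕ} {x : Chain 𝕜 A n} :
    x ∈ cyclicRel 𝕜 A n ↔ ∃ y, y - cyclic 𝕜 A n y = x := by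
  refine ⟨fun hx => ?_, ?_⟩
  · let N : Chain 𝕜 A n →L[𝕜] Chain 𝕜 A n := ∑ k ∈ Finset.range (n + 1), cyclic 𝕜 A n ^ k
    have hN : N * (1 - cyclic 𝕜 A n) = 0 := by
      rw [geom_sum_mul_neg, cyclic_pow_eq_one, sub_self]
    have hle : cyclicRel 𝕜 A n ≤ LinearMap.ker N.toLinearMap := by
      refine Submodule.topologicalClosure_minimal _ ?_ N.isClosed_ker
      rintro _ ⟨y, rfl⟩
      exact DFunLike.congr_fun hN y
    exact exists_sub_eq_of_sum_pow_eq_zero _ n (hle hx)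
  · rintro ⟨y, rfl⟩
    exact Submodule.le_topologicalClosure _ ⟨y, rfl⟩

theorem ker_cyclicMap [CompleteSpace A] [CompleteSpace D] {j : A →L[𝕜] D}
    (hj : Function.Surjective j) (n : ℕ) :
    LinearMap.ker (cyclicMap j n).toLinearMap =
      (LinearMap.ker (chainMap j n).toLinearMap).map (cyclicRel 𝕜 A n).mkQ := by
  refine le_antisymm (fun x hx => ?_) ?_
  · obtain ⟨u, rfl⟩ := (cyclicRel 𝕜 A n).mkQ_surjective x
    have hu : chainMap j n u ∈ cyclicRel 𝕜 D n := (Submodule.Quotient.mk_eq_zero _).1 hx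
    obtain ⟨d, hd⟩ := mem_cyclicRel_iff.1 hu
    obtain ⟨v, rfl⟩ := chainMap_surjective hj n d
    refine ⟨u - (v - cyclic 𝕜 A n v), ?_, ?_⟩
    · change chainMap j n _ = 0
      rw [map_sub, map_sub, chainMap_cyclic, hd, sub_self]
    · rw [map_sub, sub_eq_self]
      exact (Submodule.Quotient.mk_eq_zero _).2 (mem_cyclicRel_iff.2 ⟨v, rfl⟩)
  · rintro _ ⟨u, hu, rfl⟩
    have hu' : chainMap j n u = 0 := hu
    change cyclicMap j n _ = 0
    rw [cyclicMap_mk, hu', map_zero]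

theorem ker_cyclicMap_eq_closure_span [CompleteSpace A] [CompleteSpace D] {j : A →L[𝕜] D}
    (hj : Function.Surjective j) (n : ℕ) :
    LinearMap.ker (cyclicMap j n).toLinearMap =
      (Submodule.span 𝕜 {c : CyclicChain 𝕜 A n | ∃ a : Fin (n + 1) → A, (∃ k, j (a k) = 0) ∧
          c = (cyclicRel 𝕜 A n).mkQ (elem 𝕜 a)}).topologicalClosure := by
  refine le_antisymm ?_ ?_
  · rw [ker_cyclicMap hj, Submodule.map_le_iff_le_comap]
    refine ker_chainMap_le hj _ ?_ fun a k hk => ?_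
    · exact (Submodule.isClosed_topologicalClosure _).preimage
        (cyclicRel 𝕜 A n).mkQL.continuous
    · exact Submodule.le_topologicalClosure _ (Submodule.subset_span ⟨a, ⟨k, hk⟩, rfl⟩)
  · refine Submodule.topologicalClosure_minimal _ ?_ (cyclicMap j n).isClosed_ker
    rw [Submodule.span_le]
    rintro _ ⟨a, ⟨k, hk⟩, rfl⟩
    change cyclicMap j n _ = 0
    rw [cyclicMap_mk, chainMap_elem, elem_map_zero (k := k) hk, map_zero]

theorem cyclicMap_comp_eq_zero {i : B →L[𝕜] A} {j : A →L[𝕜] D} (h : ∀ b, j (i b) = 0) (n : ℕ)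
    (x : CyclicChain 𝕜 B n) : cyclicMap j n (cyclicMap i n x) = 0 := by
  obtain ⟨u, rfl⟩ := (cyclicRel 𝕜 B n).mkQ_surjective x
  have h0 : chainMap (j ∘L i) n = 0 := chain_ext fun b => by
    rw [chainMap_elem]
    exact elem_map_zero (k := 0) (h _)
  rw [cyclicMap_mk, cyclicMap_mk, ← chainMap_comp_apply, h0, zero_apply,
    map_zero]

/-! ### Approximate left inverses -/

/-- The operators are uniformly Lipschitz, so the set of convergence is closed and elementary
tensors suffice. -/
theorem tendsto_chainMap {Λ : Type*} {l : Filter Λ} {T : Λ → B →L[𝕜] B} {M : ℝ}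
    (hM : ∀ α, ‖T α‖ ≤ M) (hT : ∀ b, Tendsto (fun α => T α b) l (𝓝 b)) (n : ℕ)
    (x : Chain 𝕜 B n) : Tendsto (fun α => chainMap (T α) n x) l (𝓝 x) := by
  have hlip : ∀ α, LipschitzWith (M ^ (n + 1)).toNNReal (chainMap (T α) n) := fun α =>
    (chainMap (T α) n).lipschitzWith_of_opNorm_le <| by
      refine ContinuousLinearMap.opNorm_le_bound _ (by positivity) fun x => ?_
      refine (norm_chainMap_apply_le (T α) n x).trans ?_
      gcongr
      refine le_trans ?_ (Real.le_coe_toNNReal _)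
      gcongr
      exact hM α
  have heq : Equicontinuous fun α => (chainMap (T α) n : Chain 𝕜 B n → Chain 𝕜 B n) :=
    (LipschitzWith.uniformEquicontinuous _ _ hlip).equicontinuous
  induction x using chain_induction with
  | hc => exact heq.isClosed_setOfPred_tendsto continuous_id
  | hsmul c b =>
    simp only [map_smul, chainMap_elem]
    refine Tendsto.const_smul ?_ c
    exact (continuous_elem.tendsto b).comp (tendsto_pi_nhds.2 fun k => hT (b k))
  | hadd x y hx hy => simpa only [map_add] using hx.add hy

/-- If `i` has a bounded net of approximate left inverses then the induced map on cyclic chains is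
bounded below. -/
theorem norm_le_norm_cyclicMap {Λ : Type*} {l : Filter Λ} [l.NeBot] {i : B →L[𝕜] A}
    {S : Λ → A →L[𝕜] B} {M : ℝ} (hM : ∀ α, ‖S α‖ ≤ M)
    (hS : ∀ b, Tendsto (fun α => S α (i b)) l (𝓝 b)) (n : ℕ) (x : CyclicChain 𝕜 B n) :
    ‖x‖ ≤ M ^ (n + 1) * ‖cyclicMap i n x‖ := by
  obtain ⟨u, rfl⟩ := (cyclicRel 𝕜 B n).mkQ_surjective x
  have hb : ∀ α, ‖S α ∘L i‖ ≤ M * ‖i‖ := fun α =>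
    (ContinuousLinearMap.opNorm_comp_le _ _).trans (by gcongr; exact hM α)
  have ht : Tendsto (fun α => cyclicMap (S α) n (cyclicMap i n ((cyclicRel 𝕜 B n).mkQ u))) l
      (𝓝 ((cyclicRel 𝕜 B n).mkQ u)) := by
    simp only [cyclicMap_mk, ← chainMap_comp_apply]
    exact ((cyclicRel 𝕜 B n).mkQL.continuous.tendsto u).comp (tendsto_chainMap hb hS n u)
  refine le_of_tendsto ht.norm (Eventually.of_forall fun α => ?_)
  refine (norm_cyclicMap_apply_le (S α) n _).trans ?_
  gcongr
  exact hM α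

end ChainMaps

section Extension

variable {𝕜 : Type*} [RCLike 𝕜] {B A D : Type*}
  [NonUnitalNormedRing B] [NormedSpace 𝕜 B] [CompleteSpace B]
  [NonUnitalNormedRing A] [NormedSpace 𝕜 A] [CompleteSpace A]
  [NonUnitalNormedRing D] [NormedSpace 𝕜 D]

/-- Continuous operators `A → A` with values in the closed range of an injection `i : B → A` lift
to `B`, with uniform control of the norm. -/
theorem exists_lift_of_range_isClosed {i : B →L[𝕜] A} (hi : Function.Injective i)
    (hc : IsClosed (Set.range i)) {Λ : Type*} (P : Λ → A →L[𝕜] A)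
    (hP : ∀ α a, P α a ∈ Set.range i) {M : ℝ} (hM : ∀ α, ‖P α‖ ≤ M) :
    ∃ (S : Λ → A →L[𝕜] B) (K : ℝ), (∀ α, ‖S α‖ ≤ K) ∧ ∀ α a, i (S α a) = P α a := by
  let r := i.equivRange hi hc
  refine ⟨fun α => (r.symm : i.range →L[𝕜] B) ∘L (P α).codRestrict i.range (hP α),
    ‖(r.symm : i.range →L[𝕜] B)‖ * M, fun α => ?_, fun α a => ?_⟩
  · refine (ContinuousLinearMap.opNorm_comp_le _ _).trans ?_
    gcongr
    refine ContinuousLinearMap.opNorm_le_bound _ ((norm_nonneg _).trans (hM α)) fun a => ?_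
    exact (P α).le_of_opNorm_le (hM α) a
  · exact congrArg Subtype.val (r.apply_symm_apply ((P α).codRestrict i.range (hP α) a))

theorem IsExtension.exists_approx_left_inverse [IsScalarTower 𝕜 A A] [SMulCommClass 𝕜 A A]
    {i : B →L[𝕜] A} {j : A →L[𝕜] D} (h : IsExtension i j)
    {Λ : Type*} [Preorder Λ] {e : Λ → B}
    (he : IsLeftBAI e ∨ IsRightBAI e) :
    ∃ (S : Λ → A →L[𝕜] B) (K : ℝ), (∀ α, ‖S α‖ ≤ K) ∧
      ∀ b, Tendsto (fun α => S α (i b)) atTop (𝓝 b) := by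
  -- Exactness makes the range a kernel, hence a closed two-sided ideal; this lets one-sided
  -- multiplication by `i (e α)` lift to `B`.
  have hc : IsClosed (Set.range i) := by
    have : Set.range i = (j ⁻¹' {0} : Set A) := Set.ext fun a => (h.exact a).symm
    rw [this]
    exact isClosed_singleton.preimage j.continuous
  have hji : ∀ b, j (i b) = 0 := fun b => (h.exact _).2 ⟨b, rfl⟩
  rcases he with ⟨⟨M, hM⟩, ht⟩ | ⟨⟨M, hM⟩, ht⟩
  · obtain ⟨S, K, hK, hS⟩ := exists_lift_of_range_isClosed h.injective hc
      (fun α => ContinuousLinearMap.mul 𝕜 A (i (e α)))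
      (fun α a => (h.exact _).1 (by simp [h.map_mul_right, hji])) (M := ‖i‖ * M) fun α =>
        (ContinuousLinearMap.opNorm_mul_apply_le 𝕜 A _).trans
          ((i.le_opNorm _).trans (by gcongr; exact hM α))
    refine ⟨S, K, hK, fun b => ?_⟩
    have : ∀ α, S α (i b) = e α * b := fun α => h.injective <| by
      rw [hS, h.map_mul_left, ContinuousLinearMap.mul_apply']
    simpa only [this] using ht b
  · obtain ⟨S, K, hK, hS⟩ := exists_lift_of_range_isClosed h.injective hc
      (fun α => (ContinuousLinearMap.mul 𝕜 A).flip (i (e α)))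
      (fun α a => (h.exact _).1 (by simp [h.map_mul_right, hji])) (M := ‖i‖ * M) fun α =>
        ContinuousLinearMap.opNorm_le_bound _
          (mul_nonneg (norm_nonneg _) ((norm_nonneg _).trans (hM α))) fun a => by
          rw [ContinuousLinearMap.flip_apply, ContinuousLinearMap.mul_apply', mul_comm _ ‖a‖]
          refine (norm_mul_le _ _).trans ?_
          gcongr
          exact (i.le_opNorm _).trans (by gcongr; exact hM α)
    refine ⟨S, K, hK, fun b => ?_⟩
    have : ∀ α, S α (i b) = b * e α := fun α => h.injective <| by
      rw [hS, h.map_mul_left, ContinuousLinearMap.flip_apply, ContinuousLinearMap.mul_apply']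
    simpa only [this] using ht b

end Extension

end BanachCyclic

theorem lemma3p7 {𝕜 : Type*} [RCLike 𝕜] {B A D : Type*}
    [NonUnitalNormedRing B] [NormedSpace 𝕜 B] [IsScalarTower 𝕜 B B] [SMulCommClass 𝕜 B B]
    [CompleteSpace B]
    [NonUnitalNormedRing A] [NormedSpace 𝕜 A] [IsScalarTower 𝕜 A A] [SMulCommClass 𝕜 A A]
    [CompleteSpace A]
    [NonUnitalNormedRing D] [NormedSpace 𝕜 D] [IsScalarTower 𝕜 D D] [SMulCommClass 𝕜 D D]
    [CompleteSpace D]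
    (i : B →L[𝕜] A) (j : A →L[𝕜] D) (hext : BanachCyclic.IsExtension i j)
    {Λ : Type*} [Preorder Λ] [IsDirectedOrder Λ] [Nonempty Λ] (e : Λ → B)
    (he : BanachCyclic.IsLeftBAI e ∨ BanachCyclic.IsRightBAI e) (n : ℕ) :
    (∀ x, BanachCyclic.cyclicMap j n (BanachCyclic.cyclicMap i n x) = 0) ∧
    Function.Injective (BanachCyclic.cyclicMap i n) ∧
    IsClosed (Set.range (BanachCyclic.cyclicMap i n)) ∧
    Function.Surjective (BanachCyclic.cyclicMap j n) ∧
    LinearMap.ker (BanachCyclic.cyclicMap j n).toLinearMap =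
      (LinearMap.ker (BanachCyclic.chainMap j n).toLinearMap).map
        (BanachCyclic.cyclicRel 𝕜 A n).mkQ ∧
    LinearMap.ker (BanachCyclic.cyclicMap j n).toLinearMap =
      (Submodule.span 𝕜 {c : BanachCyclic.CyclicChain 𝕜 A n |
        ∃ a : Fin (n + 1) → A, (∃ k, a k ∈ Set.range i) ∧
          c = (BanachCyclic.cyclicRel 𝕜 A n).mkQ
            (BanachCyclic.elem 𝕜 a)}).topologicalClosure := by
  obtain ⟨S, K, hK, hS⟩ := hext.exists_approx_left_inverse he
  have hlow := BanachCyclic.norm_le_norm_cyclicMap hK hS n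
  have hanti : AntilipschitzWith (K ^ (n + 1)).toNNReal (BanachCyclic.cyclicMap i n) :=
    AddMonoidHomClass.antilipschitz_of_bound _ fun x => (hlow x).trans <| by
      gcongr
      exact Real.le_coe_toNNReal _
  refine ⟨BanachCyclic.cyclicMap_comp_eq_zero (fun b => (hext.exact _).2 ⟨b, rfl⟩) n,
    hanti.injective, hanti.isClosed_range (BanachCyclic.cyclicMap i n).uniformContinuous,
    BanachCyclic.cyclicMap_surjective hext.surjective n,
    BanachCyclic.ker_cyclicMap hext.surjective n, ?_⟩
  simpa only [hext.exact] using BanachCyclic.ker_cyclicMap_eq_closure_span hext.surjective n
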